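/- Let $\mathcal Z$ be a measurable space, $\rho$ a probability measure on $\mathcal Z$, and $f:\mathbb R^d\times\mathcal Z\to\mathbb R$ a loss such that $z\mapsto f(w;z)$ is measurable for every $w$ and such that, for every $z\in\mathcal Z$, the function $w\mapsto f(w;z)$ is nonnegative, convex and $L$-smooth on $\mathbb R^d$ with $L>0$ (i.e. differentiable with $\|\nabla f(w;z)-\nabla f(v;z)\|_2\le L\|w-v\|_2$ for all $w,v\in\mathbb R^d$, gradients being taken in $w$). Let $F(w)=\mathbb E_{z\sim\rho}[f(w;z)]$, let $\Omega\subseteq\mathbb R^d$ be closed and convex with Euclidean projection $\Pi_\Omega$ (for instance $\Omega=\mathbb R^d$), and let $w^*\in\arg\min_{w\in\Omega}F(w)$ with $F(w^*)<\infty$. Let $n,T\ge1$, let $S=(z_1,\dots,z_n)$ be drawn i.i.d. from $\rho$, and let $i_1,\dots,i_T$ be drawn independently (also of $S$) from the uniform distribution on $\{1,\dots,n\}$. Projected SGD with positive step sizes $\eta_1,\dots,\eta_T$ is given by $$w_1=0,\qquad w_{t+1}=\Pi_\Omega\big(w_t-\eta_t\nabla f(w_t;z_{i_t})\big),$$ and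 its weighted average iterate is $w_T^{(1)}=\big(\sum_{t=1}^T\eta_tw_t\big)/\sum_{t=1}^T\eta_t$. Assume that $\eta_1\ge\eta_2\ge\dots\ge\eta_T$ and $\eta_t\le 1/(2L)$ for all $t$. Write $\mathbb E_{S,A}$ for the expectation over $S$ and $i_1,\dots,i_T$. **Theorem.** For every $\gamma\ge1$, the random variable $F(w_T^{(1)})$ is integrable and $$\mathbb E_{S,A}\big[F(w_T^{(1)})\big]-F(w^*)\le C\bigg(\Big(\frac1\gamma+\frac{\sum_{t=1}^T\eta_t^2}{\sum_{t=1}^T\eta_t}\Big)F(w^*)+\frac{1}{\sum_{t=1}^T\eta_t}+\frac{\gamma(1+T/n)}{n}\Big(1+\sum_{t=1}^T\eta_t^2\,F(w^*)\Big)\bigg),$$ where the constant $C>0$ depends only on $L$ and on an upper bound for $\|w^*\|_2$ (and not on $d,\mathcal Z,\rho,f,\Omega,n,T,(\eta_t)$ or $\gamma$). -/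

import Mathlib

open MeasureTheory

noncomputable section

namespace ProjSGD

/-- `g` is `L`-smooth: it is differentiable and its gradient is `L`-Lipschitz on all of `ℝ^d`. -/
def LSmooth {d : ℕ} (L : ℝ) (g : EuclideanSpace ℝ (Fin d) → ℝ) : Prop :=
  Differentiable ℝ g ∧ ∀ w v : EuclideanSpace ℝ (Fin d), ‖gradient g w - gradient g v‖ ≤ L * ‖w - v‖

/-- The population risk `F(w) = 𝔼_z[f(w; z)]`, with `z` distributed according to `ρ`. -/
def risk {d : ℕ} {Z : Type*} [MeasurableSpace Z] (ρ : Measure Z)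
    (f : EuclideanSpace ℝ (Fin d) → Z → ℝ) (w : EuclideanSpace ℝ (Fin d)) : ℝ :=
  ∫ z, f w z ∂ρ

/-- The projection `Π_Ω(x)`: a point of `Ω` at minimal Euclidean distance from `x`
(it exists and is unique when `Ω` is nonempty, closed and convex). -/
def proj {d : ℕ} (Ω : Set (EuclideanSpace ℝ (Fin d))) (x : EuclideanSpace ℝ (Fin d)) :
    EuclideanSpace ℝ (Fin d) :=
  Classical.epsilon fun y => y ∈ Ω ∧ Metric.infDist x Ω = dist x y

theorem proj_spec {d : ℕ} {Ω : Set (EuclideanSpace ℝ (Fin d))} (hc : IsClosed Ω)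
    (hne : Ω.Nonempty) (x : EuclideanSpace ℝ (Fin d)) :
    proj Ω x ∈ Ω ∧ Metric.infDist x Ω = dist x (proj Ω x) :=
  Classical.epsilon_spec (p := fun y => y ∈ Ω ∧ Metric.infDist x Ω = dist x y)
    (hc.exists_infDist_eq_dist hne x)

/-- The iterates `w_1, …, w_{T+1}` of projected SGD run on the data set `S = (z_1, …, z_n)` with
step sizes `η_1, …, η_T` and drawn indices `i_1, …, i_T`:
`w_1 = 0` and `w_{t+1} = Π_Ω(w_t - η_t ∇f(w_t; z_{i_t}))`.
Positions are counted from `0`, so `iterate … 0` is `w_1`, and `η 0`, `i 0` are `η_1`, `i_1`. -/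
def iterate {d n T : ℕ} {Z : Type*} (f : EuclideanSpace ℝ (Fin d) → Z → ℝ)
    (Ω : Set (EuclideanSpace ℝ (Fin d))) (η : Fin T → ℝ) (S : Fin n → Z) (i : Fin T → Fin n) :
    Fin (T + 1) → EuclideanSpace ℝ (Fin d) :=
  Fin.induction 0 fun t w => proj Ω (w - η t • gradient (fun v => f v (S (i t))) w)

/-- The weighted average `(∑_{t=1}^T η_t w_t) / ∑_{t=1}^T η_t` of the iterates. -/
def average {d n T : ℕ} {Z : Type*} (f : EuclideanSpace ℝ (Fin d) → Z → ℝ)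
    (Ω : Set (EuclideanSpace ℝ (Fin d))) (η : Fin T → ℝ) (S : Fin n → Z) (i : Fin T → Fin n) :
    EuclideanSpace ℝ (Fin d) :=
  (∑ t, η t)⁻¹ • ∑ t, η t • iterate f Ω η S i t.castSucc

/-- The joint law of the sample `S` (`n` independent draws from `ρ`) and of the indices
`i_1, …, i_T` (independent, uniform on `{1, …, n}`, and independent of `S`). -/
def law {Z : Type*} [MeasurableSpace Z] (ρ : Measure Z) (n T : ℕ) :
    Measure ((Fin n → Z) × (Fin T → Fin n)) :=
  (Measure.pi fun _ : Fin n => ρ).prod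
    (Measure.pi fun _ : Fin T => ProbabilityTheory.uniformOn (Set.univ : Set (Fin n)))

end ProjSGD

end

/-!
Convexity and the nonincreasing steps bound the weighted empirical risk along the iterates by that
of `w*`. The excess of the population risk over the empirical risk is controlled by on-average
stability: exchanging a data point with a fresh one preserves the law of both, and the two losses
compared are at nearby outputs. A nonnegative `L`-smooth loss is self-bounding, `‖∇f‖² ≤ 2 L f`, so
that smoothness plus Young's inequality turns both the loss difference and the displacement caused
by the exchange into multiples of the losses along the trajectory, again at most those of `w*`.
A gradient step is nonexpansive, so the two trajectories separate only at the steps which draw the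
exchanged point; Young's inequality with parameter `n / T` there keeps the accumulated expansion
below `(1 + 1 / T) ^ T ≤ 3`.
-/

noncomputable section

open scoped BigOperators Gradient RealInnerProductSpace

namespace ProjSGD

section SmoothFunctions

variable {H : Type*} [NormedAddCommGroup H] [InnerProductSpace ℝ H] [CompleteSpace H]
  {g : H → ℝ} {L η γ : ℝ}

theorem hasDerivAt_comp_add_smul {w u : H} {s : ℝ} (hg : DifferentiableAt ℝ g (w + s • u)) :
    HasDerivAt (fun r : ℝ => g (w + r • u)) ⟪∇ g (w + s • u), u⟫ s := by
  have hline : HasDerivAt (fun r : ℝ => w + r • u) u s := by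
    simpa using ((hasDerivAt_id s).smul_const u).const_add w
  rw [inner_gradient_left]
  exact hg.hasFDerivAt.comp_hasDerivAt s hline

theorem le_add_inner_gradient_add_sq_norm (hd : Differentiable ℝ g)
    (hlip : ∀ w v, ‖∇ g w - ∇ g v‖ ≤ L * ‖w - v‖) (w v : H) :
    g v ≤ g w + ⟪∇ g w, v - w⟫ + L / 2 * ‖v - w‖ ^ 2 := by
  set u := v - w
  let φ : ℝ → ℝ := fun s => g (w + s • u) - s * ⟪∇ g w, u⟫ - L / 2 * ‖u‖ ^ 2 * s ^ 2
  have hφ : ∀ s, HasDerivAt φ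
      (⟪∇ g (w + s • u), u⟫ - ⟪∇ g w, u⟫ - L / 2 * ‖u‖ ^ 2 * (2 * s)) s := fun s => by
    have hquad : HasDerivAt (fun r : ℝ => r ^ 2) (2 * s) s := by simpa using hasDerivAt_pow 2 s
    exact ((hasDerivAt_comp_add_smul (hd _)).sub (hasDerivAt_mul_const _)).sub (hquad.const_mul _)
  have hanti : AntitoneOn φ (Set.Icc 0 1) := by
    refine antitoneOn_of_deriv_nonpos (convex_Icc 0 1)
      (fun s _ => (hφ s).continuousAt.continuousWithinAt)
      (fun s _ => (hφ s).differentiableAt.differentiableWithinAt) fun s hs => ?_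
    rw [interior_Icc] at hs
    have hgrad := hlip (w + s • u) w
    rw [add_sub_cancel_left, norm_smul, Real.norm_of_nonneg hs.1.le] at hgrad
    have hinner : ⟪∇ g (w + s • u) - ∇ g w, u⟫ ≤ L * (s * ‖u‖) * ‖u‖ :=
      (real_inner_le_norm _ _).trans (mul_le_mul_of_nonneg_right hgrad (norm_nonneg u))
    rw [(hφ s).deriv, ← inner_sub_left]
    linarith
  have hle : φ 1 ≤ φ 0 :=
    hanti (Set.left_mem_Icc.2 zero_le_one) (Set.right_mem_Icc.2 zero_le_one) zero_le_one
  have hend : w + u = v := add_sub_cancel w v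
  simp only [φ, one_smul, zero_smul, add_zero, one_mul, zero_mul, sub_zero, one_pow, mul_one,
    zero_pow two_ne_zero, mul_zero, hend] at hle
  linarith

theorem add_inner_gradient_le_of_convexOn (hc : ConvexOn ℝ Set.univ g) {w : H}
    (hd : DifferentiableAt ℝ g w) (v : H) : g w + ⟪∇ g w, v - w⟫ ≤ g v := by
  have hline : ConvexOn ℝ Set.univ fun s : ℝ => g (AffineMap.lineMap w v s) :=
    hc.comp_affineMap (AffineMap.lineMap w v)
  have hderiv : HasDerivAt (fun s : ℝ => g (AffineMap.lineMap w v s)) ⟪∇ g w, v - w⟫ 0 := by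
    have hd' : DifferentiableAt ℝ g (w + (0 : ℝ) • (v - w)) := by simpa using hd
    simpa [AffineMap.lineMap_apply, add_comm] using hasDerivAt_comp_add_smul hd'
  have hslope := hline.le_slope_of_hasDerivAt (Set.mem_univ 0) (Set.mem_univ 1) zero_lt_one hderiv
  simp only [slope_def_field, AffineMap.lineMap_apply_one, AffineMap.lineMap_apply_zero, sub_zero,
    div_one] at hslope
  linarith

theorem sq_norm_gradient_le (hL : 0 < L) (hd : Differentiable ℝ g)
    (hlip : ∀ w v, ‖∇ g w - ∇ g v‖ ≤ L * ‖w - v‖) (h0 : ∀ w, 0 ≤ g w) (w : H) :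
    ‖∇ g w‖ ^ 2 ≤ 2 * L * g w := by
  have hstep := le_add_inner_gradient_add_sq_norm hd hlip w (w - L⁻¹ • ∇ g w)
  rw [sub_sub_cancel_left, inner_neg_right, real_inner_smul_right, real_inner_self_eq_norm_sq,
    norm_neg, norm_smul, Real.norm_of_nonneg (inv_nonneg.2 hL.le)] at hstep
  have hquad : L / 2 * (L⁻¹ * ‖∇ g w‖) ^ 2 = L⁻¹ * ‖∇ g w‖ ^ 2 / 2 := by field_simp
  have hle : L⁻¹ * ‖∇ g w‖ ^ 2 ≤ 2 * g w := by linarith [h0 (w - L⁻¹ • ∇ g w)]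
  rw [inv_mul_le_iff₀ hL] at hle
  linarith

theorem add_inner_gradient_add_sq_norm_gradient_sub_le (hL : 0 < L) (hd : Differentiable ℝ g)
    (hlip : ∀ w v, ‖∇ g w - ∇ g v‖ ≤ L * ‖w - v‖) (hc : ConvexOn ℝ Set.univ g) (w v : H) :
    g v + ⟪∇ g v, w - v⟫ + L⁻¹ * ‖∇ g w - ∇ g v‖ ^ 2 / 2 ≤ g w := by
  set q := ∇ g w - ∇ g v with hq
  have hupper := le_add_inner_gradient_add_sq_norm hd hlip w (w - L⁻¹ • q)
  have hlower := add_inner_gradient_le_of_convexOn hc (hd v) (w - L⁻¹ • q)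
  rw [sub_right_comm, inner_sub_right] at hlower
  rw [sub_sub_cancel_left, inner_neg_right, norm_neg, norm_smul,
    Real.norm_of_nonneg (inv_nonneg.2 hL.le)] at hupper
  have hinner : ⟪∇ g w, L⁻¹ • q⟫ - ⟪∇ g v, L⁻¹ • q⟫ = L⁻¹ * ‖q‖ ^ 2 := by
    rw [← inner_sub_left, ← hq, real_inner_smul_right, real_inner_self_eq_norm_sq]
  have hquad : L / 2 * (L⁻¹ * ‖q‖) ^ 2 = L⁻¹ * ‖q‖ ^ 2 / 2 := by field_simp
  linarith

theorem sq_norm_gradient_sub_le_inner (hL : 0 < L) (hd : Differentiable ℝ g)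
    (hlip : ∀ w v, ‖∇ g w - ∇ g v‖ ≤ L * ‖w - v‖) (hc : ConvexOn ℝ Set.univ g) (w v : H) :
    ‖∇ g w - ∇ g v‖ ^ 2 ≤ L * ⟪∇ g w - ∇ g v, w - v⟫ := by
  have hwv := add_inner_gradient_add_sq_norm_gradient_sub_le hL hd hlip hc w v
  have hvw := add_inner_gradient_add_sq_norm_gradient_sub_le hL hd hlip hc v w
  rw [norm_sub_rev, ← neg_sub w v, inner_neg_right] at hvw
  rw [inner_sub_left, ← inv_mul_le_iff₀ hL]
  linarith

theorem norm_gradient_step_sub_le (hL : 0 < L) (hη : 0 ≤ η) (hηL : η * L ≤ 2)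
    (hd : Differentiable ℝ g) (hlip : ∀ w v, ‖∇ g w - ∇ g v‖ ≤ L * ‖w - v‖)
    (hc : ConvexOn ℝ Set.univ g) (w v : H) :
    ‖(w - η • ∇ g w) - (v - η • ∇ g v)‖ ≤ ‖w - v‖ := by
  set q := ∇ g w - ∇ g v
  have hcoc : ‖q‖ ^ 2 ≤ L * ⟪q, w - v⟫ := sq_norm_gradient_sub_le_inner hL hd hlip hc w v
  have hmono : 0 ≤ ⟪q, w - v⟫ := nonneg_of_mul_nonneg_right ((sq_nonneg ‖q‖).trans hcoc) hL
  have hdiff : (w - η • ∇ g w) - (v - η • ∇ g v) = (w - v) - η • q := by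
    simp only [q]
    module
  refine le_of_sq_le_sq ?_ (norm_nonneg _)
  rw [hdiff, norm_sub_sq_real, real_inner_smul_right, norm_smul, Real.norm_of_nonneg hη, mul_pow,
    real_inner_comm]
  have hquad : η ^ 2 * ‖q‖ ^ 2 ≤ η ^ 2 * (L * ⟪q, w - v⟫) := by gcongr
  have hcoef : η * (η * L) * ⟪q, w - v⟫ ≤ η * 2 * ⟪q, w - v⟫ := by gcongr
  linarith

theorem le_one_add_mul_add_sq_norm (hL : 0 < L) (hγ : 0 < γ) (hd : Differentiable ℝ g)
    (hlip : ∀ w v, ‖∇ g w - ∇ g v‖ ≤ L * ‖w - v‖) (h0 : ∀ w, 0 ≤ g w) (w v : H) :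
    g v ≤ (1 + L / γ) * g w + (γ + L) / 2 * ‖v - w‖ ^ 2 := by
  have hupper := le_add_inner_gradient_add_sq_norm hd hlip w v
  have hinner := real_inner_le_norm (∇ g w) (v - w)
  have hyoung : ‖∇ g w‖ * ‖v - w‖ ≤ γ⁻¹ * ‖∇ g w‖ ^ 2 / 2 + γ / 2 * ‖v - w‖ ^ 2 := by
    have hsq : 0 ≤ γ⁻¹ / 2 * (‖∇ g w‖ - γ * ‖v - w‖) ^ 2 := by positivity
    have hexpand : γ⁻¹ / 2 * (‖∇ g w‖ - γ * ‖v - w‖) ^ 2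
        = γ⁻¹ * ‖∇ g w‖ ^ 2 / 2 + γ / 2 * ‖v - w‖ ^ 2 - ‖∇ g w‖ * ‖v - w‖ := by
      field_simp
      ring
    linarith
  have hself : γ⁻¹ * ‖∇ g w‖ ^ 2 ≤ γ⁻¹ * (2 * L * g w) := by
    gcongr
    exact sq_norm_gradient_le hL hd hlip h0 w
  have hcoef : (1 + L / γ) * g w = g w + γ⁻¹ * (2 * L * g w) / 2 := by field_simp
  linarith

end SmoothFunctions

section Projection

theorem norm_sub_le_of_inner_nonpos {E : Type*} [NormedAddCommGroup E] [InnerProductSpace ℝ E]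
    {x y p q : E} (hp : ⟪x - p, q - p⟫ ≤ 0) (hq : ⟪y - q, p - q⟫ ≤ 0) :
    ‖p - q‖ ≤ ‖x - y‖ := by
  have hsplit : ‖p - q‖ ^ 2 = ⟪x - y, p - q⟫ + ⟪x - p, q - p⟫ + ⟪y - q, p - q⟫ := by
    rw [← real_inner_self_eq_norm_sq, ← neg_sub p q, inner_neg_right, ← sub_eq_add_neg,
      ← inner_sub_left, ← inner_add_left]
    congr 1
    abel
  have hle : ‖p - q‖ * ‖p - q‖ ≤ ‖x - y‖ * ‖p - q‖ := by
    linarith [real_inner_le_norm (x - y) (p - q)]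
  rcases (norm_nonneg (p - q)).eq_or_lt with hzero | hpos
  · rw [← hzero]
    exact norm_nonneg _
  · exact le_of_mul_le_mul_right hle hpos

variable {d : ℕ} {Ω : Set (EuclideanSpace ℝ (Fin d))} {y : EuclideanSpace ℝ (Fin d)}

theorem inner_sub_proj_nonpos (hc : IsClosed Ω) (hconv : Convex ℝ Ω) (hy : y ∈ Ω)
    (x : EuclideanSpace ℝ (Fin d)) : ⟪x - proj Ω x, y - proj Ω x⟫ ≤ 0 := by
  obtain ⟨hmem, hdist⟩ := proj_spec hc ⟨y, hy⟩ x
  refine (norm_eq_iInf_iff_real_inner_le_zero hconv hmem).1 ?_ y hy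
  simp only [← dist_eq_norm, ← hdist, Metric.infDist_eq_iInf]

theorem lipschitzWith_proj (hc : IsClosed Ω) (hconv : Convex ℝ Ω) (hne : Ω.Nonempty) :
    LipschitzWith 1 (proj Ω) :=
  LipschitzWith.mk_one fun x y => by
    rw [dist_eq_norm, dist_eq_norm]
    exact norm_sub_le_of_inner_nonpos
      (inner_sub_proj_nonpos hc hconv (proj_spec hc hne y).1 x)
      (inner_sub_proj_nonpos hc hconv (proj_spec hc hne x).1 y)

theorem norm_proj_sub_proj_le (hc : IsClosed Ω) (hconv : Convex ℝ Ω) (hne : Ω.Nonempty)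
    (x y : EuclideanSpace ℝ (Fin d)) : ‖proj Ω x - proj Ω y‖ ≤ ‖x - y‖ := by
  simpa [dist_eq_norm] using (lipschitzWith_proj hc hconv hne).dist_le_mul x y

theorem proj_eq_self (hc : IsClosed Ω) (hy : y ∈ Ω) : proj Ω y = y := by
  have hdist := (proj_spec hc ⟨y, hy⟩ y).2
  rw [Metric.infDist_zero_of_mem hy] at hdist
  exact (dist_eq_zero.1 hdist.symm).symm

theorem norm_proj_sub_le (hc : IsClosed Ω) (hconv : Convex ℝ Ω) (hy : y ∈ Ω)
    (x : EuclideanSpace ℝ (Fin d)) : ‖proj Ω x - y‖ ≤ ‖x - y‖ := by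
  simpa only [proj_eq_self hc hy] using norm_proj_sub_proj_le hc hconv ⟨y, hy⟩ x y

end Projection

section ProjectedGradientStep

variable {d : ℕ} {Ω : Set (EuclideanSpace ℝ (Fin d))} {g h : EuclideanSpace ℝ (Fin d) → ℝ}
  {L η p : ℝ}

theorem sq_norm_proj_step_sub_le (hL : 0 < L) (hη : 0 ≤ η) (hg : LSmooth L g)
    (hg0 : ∀ w, 0 ≤ g w) (hcv : ConvexOn ℝ Set.univ g) (hc : IsClosed Ω) (hconv : Convex ℝ Ω)
    {y : EuclideanSpace ℝ (Fin d)} (hy : y ∈ Ω) (w : EuclideanSpace ℝ (Fin d)) :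
    ‖proj Ω (w - η • ∇ g w) - y‖ ^ 2
      ≤ ‖w - y‖ ^ 2 + 2 * η * (g y - g w) + 2 * L * η ^ 2 * g w := by
  have hconvex : g w - g y ≤ ⟪∇ g w, w - y⟫ := by
    have := add_inner_gradient_le_of_convexOn hcv (hg.1 w) y
    rw [← neg_sub w y, inner_neg_right] at this
    linarith
  have hself : ‖∇ g w‖ ^ 2 ≤ 2 * L * g w := sq_norm_gradient_le hL hg.1 hg.2 hg0 w
  calc ‖proj Ω (w - η • ∇ g w) - y‖ ^ 2
      ≤ ‖w - η • ∇ g w - y‖ ^ 2 := by gcongr; exact norm_proj_sub_le hc hconv hy _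
    _ = ‖w - y‖ ^ 2 - 2 * η * ⟪∇ g w, w - y⟫ + η ^ 2 * ‖∇ g w‖ ^ 2 := by
        rw [sub_right_comm, norm_sub_sq_real, real_inner_smul_right, norm_smul,
          Real.norm_of_nonneg hη, mul_pow, real_inner_comm, mul_assoc]
    _ ≤ ‖w - y‖ ^ 2 - 2 * η * (g w - g y) + η ^ 2 * (2 * L * g w) := by gcongr
    _ = ‖w - y‖ ^ 2 + 2 * η * (g y - g w) + 2 * L * η ^ 2 * g w := by ring

theorem norm_proj_step_sub_proj_step_le (hL : 0 < L) (hη : 0 ≤ η) (hηL : η * L ≤ 2)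
    (hg : LSmooth L g) (hcv : ConvexOn ℝ Set.univ g) (hc : IsClosed Ω) (hconv : Convex ℝ Ω)
    (hne : Ω.Nonempty) (w v : EuclideanSpace ℝ (Fin d)) :
    ‖proj Ω (w - η • ∇ g w) - proj Ω (v - η • ∇ g v)‖ ≤ ‖w - v‖ :=
  (norm_proj_sub_proj_le hc hconv hne _ _).trans
    (norm_gradient_step_sub_le hL hη hηL hg.1 hg.2 hcv w v)

theorem sq_norm_gradient_sub_gradient_le (hL : 0 < L) (hg : LSmooth L g) (hh : LSmooth L h)
    (hg0 : ∀ w, 0 ≤ g w) (hh0 : ∀ w, 0 ≤ h w) (w v : EuclideanSpace ℝ (Fin d)) :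
    ‖∇ g w - ∇ h v‖ ^ 2 ≤ 4 * L * (g w + h v) := by
  calc ‖∇ g w - ∇ h v‖ ^ 2 ≤ (‖∇ g w‖ + ‖∇ h v‖) ^ 2 := by gcongr; exact norm_sub_le _ _
    _ ≤ 2 * (‖∇ g w‖ ^ 2 + ‖∇ h v‖ ^ 2) := add_sq_le
    _ ≤ 2 * (2 * L * g w + 2 * L * h v) := by
        gcongr
        · exact sq_norm_gradient_le hL hg.1 hg.2 hg0 w
        · exact sq_norm_gradient_le hL hh.1 hh.2 hh0 v
    _ = 4 * L * (g w + h v) := by ring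

theorem add_sq_le_one_add_mul (hp : 0 < p) (a b : ℝ) :
    (a + b) ^ 2 ≤ (1 + p) * a ^ 2 + (1 + 1 / p) * b ^ 2 := by
  have hsq : 0 ≤ 1 / p * (p * a - b) ^ 2 := by positivity
  have hexpand : 1 / p * (p * a - b) ^ 2
      = (1 + p) * a ^ 2 + (1 + 1 / p) * b ^ 2 - (a + b) ^ 2 := by
    field_simp
    ring
  linarith

theorem sq_norm_proj_step_sub_proj_step_le (hL : 0 < L) (hη : 0 ≤ η) (hp : 0 < p)
    (hg : LSmooth L g) (hh : LSmooth L h) (hg0 : ∀ w, 0 ≤ g w) (hh0 : ∀ w, 0 ≤ h w)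
    (hc : IsClosed Ω) (hconv : Convex ℝ Ω) (hne : Ω.Nonempty)
    (w v : EuclideanSpace ℝ (Fin d)) :
    ‖proj Ω (w - η • ∇ g w) - proj Ω (v - η • ∇ h v)‖ ^ 2
      ≤ (1 + p) * ‖w - v‖ ^ 2 + (1 + 1 / p) * (4 * L * η ^ 2 * (g w + h v)) := by
  have hgrad := sq_norm_gradient_sub_gradient_le hL hg hh hg0 hh0 w v
  have hdist : ‖proj Ω (w - η • ∇ g w) - proj Ω (v - η • ∇ h v)‖
      ≤ ‖w - v‖ + η * ‖∇ g w - ∇ h v‖ := by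
    refine (norm_proj_sub_proj_le hc hconv hne _ _).trans ?_
    rw [sub_sub_sub_comm, ← smul_sub]
    exact (norm_sub_le _ _).trans_eq (by rw [norm_smul, Real.norm_of_nonneg hη])
  calc ‖proj Ω (w - η • ∇ g w) - proj Ω (v - η • ∇ h v)‖ ^ 2
      ≤ (‖w - v‖ + η * ‖∇ g w - ∇ h v‖) ^ 2 := by gcongr
    _ ≤ (1 + p) * ‖w - v‖ ^ 2 + (1 + 1 / p) * (η * ‖∇ g w - ∇ h v‖) ^ 2 :=
        add_sq_le_one_add_mul hp _ _
    _ = (1 + p) * ‖w - v‖ ^ 2 + (1 + 1 / p) * (η ^ 2 * ‖∇ g w - ∇ h v‖ ^ 2) := by rw [mul_pow]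
    _ ≤ (1 + p) * ‖w - v‖ ^ 2 + (1 + 1 / p) * (η ^ 2 * (4 * L * (g w + h v))) := by gcongr
    _ = (1 + p) * ‖w - v‖ ^ 2 + (1 + 1 / p) * (4 * L * η ^ 2 * (g w + h v)) := by ring

end ProjectedGradientStep

section UniformIndices

variable {ι κ : Type*} [Fintype ι] [DecidableEq ι] [Fintype κ]

theorem expect_apply_eq_expect_expect [Nonempty κ] (t : ι) (h : κ → (ι → κ) → ℝ)
    (hupdate : ∀ k i k', h k (Function.update i t k') = h k i) :
    𝔼 i, h (i t) i = 𝔼 i, 𝔼 k, h k i := by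
  let resample : (ι → κ) × κ ≃ (ι → κ) × κ :=
    Function.Involutive.toPerm (fun x => (Function.update x.1 t x.2, x.1 t)) fun x => by simp
  calc 𝔼 i, h (i t) i = 𝔼 i : ι → κ, 𝔼 _k : κ, h (i t) i := by
        simp only [Fintype.expect_const]
    _ = 𝔼 x : (ι → κ) × κ, h (x.1 t) x.1 := by
        rw [← Finset.univ_product_univ, Finset.expect_product]
    _ = 𝔼 x : (ι → κ) × κ, h x.2 x.1 :=
        Fintype.expect_equiv resample _ _ fun x => (hupdate _ _ _).symm
    _ = 𝔼 i, 𝔼 k, h k i := by rw [← Finset.univ_product_univ, Finset.expect_product]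

theorem expect_ite_apply_eq [DecidableEq κ] (t : ι) (k : κ) (X : (ι → κ) → ℝ)
    (hX : ∀ i k', X (Function.update i t k') = X i) :
    𝔼 i, (if i t = k then X i else 0) = (𝔼 i, X i) / Fintype.card κ := by
  have : Nonempty κ := ⟨k⟩
  rw [expect_apply_eq_expect_expect t (fun l i => if l = k then X i else 0)
    (fun l i k' => by rw [hX]), Finset.expect_div]
  refine Finset.expect_congr rfl fun i _ => ?_
  simp only [Fintype.expect_eq_sum_div_card, Finset.sum_ite_eq', Finset.mem_univ, if_true]

end UniformIndices

section WeightedAverages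

theorem convexOn_sq_norm {E : Type*} [NormedAddCommGroup E] [NormedSpace ℝ E] :
    ConvexOn ℝ Set.univ fun x : E => ‖x‖ ^ 2 :=
  convexOn_univ_norm.pow (fun _ _ => norm_nonneg _) 2

theorem map_weighted_average_le {ι E : Type*} [Fintype ι] [Nonempty ι] [AddCommGroup E]
    [Module ℝ E] {η : ι → ℝ} (hη : ∀ t, 0 < η t) {g : E → ℝ} (hg : ConvexOn ℝ Set.univ g)
    (x : ι → E) :
    g ((∑ t, η t)⁻¹ • ∑ t, η t • x t) ≤ (∑ t, η t)⁻¹ * ∑ t, η t * g (x t) :=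
  hg.map_centerMass_le (fun t _ => (hη t).le)
    (Finset.sum_pos (fun t _ => hη t) Finset.univ_nonempty) fun t _ => Set.mem_univ (x t)

end WeightedAverages

section Recursions

variable {T : ℕ} {D : Fin (T + 1) → ℝ} {G b η : Fin T → ℝ} {F L c H : ℝ}

theorem sum_castSucc_sub_succ (D : Fin (T + 1) → ℝ) :
    ∑ t : Fin T, (D t.castSucc - D t.succ) = D 0 - D (Fin.last T) := by
  have hsplit := (Fin.sum_univ_castSucc D).symm.trans (Fin.sum_univ_succ D)
  rw [Finset.sum_sub_distrib]
  linarith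

theorem sum_mul_castSucc_sub_succ_le (hD : ∀ m, 0 ≤ D m) (hη : ∀ t, 0 ≤ η t) (hanti : Antitone η)
    (hH : ∀ t, η t ≤ H) (hH0 : 0 ≤ H) :
    ∑ t, η t * (D t.castSucc - D t.succ) ≤ H * D 0 := by
  induction T generalizing H with
  | zero => simpa using mul_nonneg hH0 (hD 0)
  | succ T ih =>
    have htail : ∑ t : Fin T, η t.succ * (D t.succ.castSucc - D t.succ.succ) ≤ η 0 * D 1 :=
      ih (D := fun m => D m.succ) (η := fun t => η t.succ) (fun _ => hD _) (fun _ => hη _)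
        (fun _ _ hst => hanti (Fin.succ_le_succ_iff.2 hst)) (fun _ => hanti (Fin.zero_le _)) (hη 0)
    have hhead : η 0 * D 0 ≤ H * D 0 := mul_le_mul_of_nonneg_right (hH 0) (hD 0)
    rw [Fin.sum_univ_succ, Fin.castSucc_zero, Fin.succ_zero_eq_one]
    linarith

theorem sum_sq_mul_le_of_descent (hL : 0 < L) (hη : ∀ t, 0 ≤ η t) (hanti : Antitone η)
    (hηL : ∀ t, η t ≤ 1 / (2 * L)) (hD : ∀ m, 0 ≤ D m) (hG : ∀ t, 0 ≤ G t)
    (hdesc : ∀ t, D t.succ ≤ D t.castSucc + 2 * η t * (F - G t) + 2 * L * η t ^ 2 * G t) :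
    ∑ t, η t ^ 2 * G t ≤ D 0 / (2 * L) + 2 * (∑ t, η t ^ 2) * F := by
  have hterm : ∀ t, η t ^ 2 * G t - 2 * η t ^ 2 * F ≤ η t * (D t.castSucc - D t.succ) := fun t => by
    have hstep : 2 * L * η t ≤ 1 := by
      have := hηL t
      rwa [le_div_iff₀ (by positivity), mul_comm] at this
    have hquad : 2 * L * η t * (η t * G t) ≤ 1 * (η t * G t) :=
      mul_le_mul_of_nonneg_right hstep (mul_nonneg (hη t) (hG t))
    calc η t ^ 2 * G t - 2 * η t ^ 2 * F = η t * (η t * G t - 2 * η t * F) := by ring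
      _ ≤ η t * (D t.castSucc - D t.succ) :=
        mul_le_mul_of_nonneg_left (by linarith [hdesc t]) (hη t)
  have habel := sum_mul_castSucc_sub_succ_le hD hη hanti hηL (by positivity)
  have hsum := Finset.sum_le_sum (s := Finset.univ) fun t _ => hterm t
  rw [Finset.sum_sub_distrib, ← Finset.sum_mul, ← Finset.mul_sum] at hsum
  rw [one_div_mul_eq_div] at habel
  linarith

theorem sum_mul_le_of_descent (hL : 0 < L) (hη : ∀ t, 0 ≤ η t) (hanti : Antitone η)
    (hηL : ∀ t, η t ≤ 1 / (2 * L)) (hD : ∀ m, 0 ≤ D m) (hG : ∀ t, 0 ≤ G t)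
    (hdesc : ∀ t, D t.succ ≤ D t.castSucc + 2 * η t * (F - G t) + 2 * L * η t ^ 2 * G t) :
    ∑ t, η t * G t ≤ D 0 + (∑ t, η t + 2 * L * ∑ t, η t ^ 2) * F := by
  have hterm : ∀ t, 2 * (η t * G t) ≤
      (D t.castSucc - D t.succ) + 2 * (η t * F) + 2 * L * (η t ^ 2 * G t) := fun t => by
    linarith [hdesc t]
  have hsum := Finset.sum_le_sum (s := Finset.univ) fun t _ => hterm t
  simp only [Finset.sum_add_distrib, ← Finset.mul_sum, ← Finset.sum_mul,
    sum_castSucc_sub_succ] at hsum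
  have hsq : 2 * L * ∑ t, η t ^ 2 * G t ≤ 2 * L * (D 0 / (2 * L) + 2 * (∑ t, η t ^ 2) * F) :=
    mul_le_mul_of_nonneg_left (sum_sq_mul_le_of_descent hL hη hanti hηL hD hG hdesc) (by positivity)
  rw [mul_add, mul_div_cancel₀ _ (by positivity)] at hsq
  linarith [hD (Fin.last T)]

theorem castSucc_le_of_le_one_add_mul_add (hc : 0 ≤ c) (hD : ∀ m, 0 ≤ D m) (hb : ∀ t, 0 ≤ b t)
    (hrec : ∀ t, D t.succ ≤ (1 + c) * D t.castSucc + b t) (t : Fin T) :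
    D t.castSucc ≤ (D 0 + ∑ s, b s) * Real.exp (T * c) := by
  let u : ℕ → ℝ := fun m => if hm : m < T + 1 then D ⟨m, hm⟩ else 0
  let b' : ℕ → ℝ := fun m => if hm : m < T then b ⟨m, hm⟩ else 0
  have hu0 : ∀ m, 0 ≤ u m := fun m => by
    simp only [u]
    split_ifs
    exacts [hD _, le_rfl]
  have hb0 : ∀ m, 0 ≤ b' m := fun m => by
    simp only [b']
    split_ifs
    exacts [hb _, le_rfl]
  have hstep : ∀ m, u (m + 1) ≤ (1 + c) * u m + b' m := fun m => by
    rcases lt_or_ge m T with hm | hm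
    · simpa [u, b', hm, hm.le, Nat.lt_succ_of_lt hm] using hrec ⟨m, hm⟩
    · have hzero : u (m + 1) = 0 := dif_neg (by omega)
      rw [hzero]
      exact add_nonneg (mul_nonneg (by linarith) (hu0 m)) (hb0 m)
  have hgronwall := discrete_gronwall_Ico (n₁ := T) (hu0 0) (fun m _ => hstep m) (fun _ _ => hc)
    (fun m _ => hb0 m) (Finset.mem_Ico.2 ⟨t.val.zero_le, t.isLt⟩)
  have hu_zero : u 0 = D 0 := dif_pos T.succ_pos
  have hu_val : u t = D t.castSucc := dif_pos (Nat.lt_succ_of_lt t.isLt)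
  have hsum : ∑ m ∈ Finset.range T, b' m = ∑ s, b s := by simp [Finset.sum_range, b']
  rw [hu_val, hu_zero, ← Finset.range_eq_Ico, hsum, Finset.sum_const, Finset.card_range,
    nsmul_eq_mul] at hgronwall
  exact hgronwall

end Recursions

/-- A loss which is nonnegative and `L`-smooth in its first argument, for every data point. -/
structure IsSmoothLoss {d : ℕ} {Z : Type*} (L : ℝ) (f : EuclideanSpace ℝ (Fin d) → Z → ℝ) :
    Prop where
  pos : 0 < L
  nonneg : ∀ z w, 0 ≤ f w z
  smooth : ∀ z, LSmooth L fun w => f w z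

/-- The empirical risk `F_S(w) = n⁻¹ ∑_k f(w; z_k)` on the sample `S = (z_1, …, z_n)`. -/
def empiricalRisk {d n : ℕ} {Z : Type*} (f : EuclideanSpace ℝ (Fin d) → Z → ℝ) (S : Fin n → Z)
    (w : EuclideanSpace ℝ (Fin d)) : ℝ :=
  𝔼 k, f w (S k)

section Iterates

variable {d n T : ℕ} {Z : Type*} {f : EuclideanSpace ℝ (Fin d) → Z → ℝ}
  {Ω : Set (EuclideanSpace ℝ (Fin d))} {η : Fin T → ℝ} {L p : ℝ}

theorem empiricalRisk_nonneg (hf : IsSmoothLoss L f) (S : Fin n → Z)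
    (w : EuclideanSpace ℝ (Fin d)) : 0 ≤ empiricalRisk f S w :=
  Finset.expect_nonneg fun k _ => hf.nonneg (S k) w

theorem convexOn_empiricalRisk (hcv : ∀ z, ConvexOn ℝ Set.univ fun w => f w z) (S : Fin n → Z) :
    ConvexOn ℝ Set.univ (empiricalRisk f S) :=
  ⟨convex_univ, fun x hx y hy a b ha hb hab => by
    simp only [empiricalRisk, smul_eq_mul, Finset.mul_expect, ← Finset.expect_add_distrib]
    exact Finset.expect_le_expect fun k _ => (hcv (S k)).2 hx hy ha hb hab⟩

theorem iterate_zero (S : Fin n → Z) (i : Fin T → Fin n) : iterate f Ω η S i 0 = 0 :=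
  rfl

theorem iterate_succ (S : Fin n → Z) (i : Fin T → Fin n) (t : Fin T) :
    iterate f Ω η S i t.succ = proj Ω (iterate f Ω η S i t.castSucc
      - η t • ∇ (fun v => f v (S (i t))) (iterate f Ω η S i t.castSucc)) :=
  rfl

theorem iterate_congr (S : Fin n → Z) {i j : Fin T → Fin n} {m : Fin (T + 1)}
    (hij : ∀ s : Fin T, s.castSucc < m → i s = j s) :
    iterate f Ω η S i m = iterate f Ω η S j m := by
  induction m using Fin.induction with
  | zero => rw [iterate_zero, iterate_zero]
  | succ t ih =>
    rw [iterate_succ, iterate_succ, hij t Fin.castSucc_lt_succ,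
      ih fun s hs => hij s (hs.trans Fin.castSucc_lt_succ)]

theorem iterate_update_index (S : Fin n → Z) (i : Fin T → Fin n) (t : Fin T) (k : Fin n) :
    iterate f Ω η S (Function.update i t k) t.castSucc = iterate f Ω η S i t.castSucc :=
  iterate_congr S fun _ hs => Function.update_of_ne (Fin.castSucc_lt_castSucc_iff.1 hs).ne _ _

section Optimization

variable {y : EuclideanSpace ℝ (Fin d)}

theorem sq_norm_iterate_succ_sub_le (hf : IsSmoothLoss L f)
    (hcv : ∀ z, ConvexOn ℝ Set.univ fun w => f w z) (hc : IsClosed Ω) (hconv : Convex ℝ Ω)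
    (hη : ∀ t, 0 ≤ η t) (hy : y ∈ Ω) (S : Fin n → Z) (i : Fin T → Fin n) (t : Fin T) :
    ‖iterate f Ω η S i t.succ - y‖ ^ 2
      ≤ ‖iterate f Ω η S i t.castSucc - y‖ ^ 2
        + 2 * η t * (f y (S (i t)) - f (iterate f Ω η S i t.castSucc) (S (i t)))
        + 2 * L * η t ^ 2 * f (iterate f Ω η S i t.castSucc) (S (i t)) := by
  rw [iterate_succ]
  exact sq_norm_proj_step_sub_le hf.pos (hη t) (hf.smooth _) (hf.nonneg _) (hcv _) hc hconv hy _

theorem expect_sq_norm_iterate_succ_sub_le [NeZero n] (hf : IsSmoothLoss L f)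
    (hcv : ∀ z, ConvexOn ℝ Set.univ fun w => f w z) (hc : IsClosed Ω) (hconv : Convex ℝ Ω)
    (hη : ∀ t, 0 ≤ η t) (hy : y ∈ Ω) (S : Fin n → Z) (t : Fin T) :
    𝔼 i, ‖iterate f Ω η S i t.succ - y‖ ^ 2
      ≤ 𝔼 i, ‖iterate f Ω η S i t.castSucc - y‖ ^ 2
        + 2 * η t * (empiricalRisk f S y
          - 𝔼 i, empiricalRisk f S (iterate f Ω η S i t.castSucc))
        + 2 * L * η t ^ 2 * 𝔼 i, empiricalRisk f S (iterate f Ω η S i t.castSucc) := by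
  have hfresh_y : 𝔼 i : Fin T → Fin n, f y (S (i t)) = empiricalRisk f S y := by
    rw [expect_apply_eq_expect_expect t (fun k _ => f y (S k)) fun _ _ _ => rfl,
      Fintype.expect_const, empiricalRisk]
  have hfresh_iterate : 𝔼 i, f (iterate f Ω η S i t.castSucc) (S (i t))
      = 𝔼 i, empiricalRisk f S (iterate f Ω η S i t.castSucc) :=
    expect_apply_eq_expect_expect t (fun k i => f (iterate f Ω η S i t.castSucc) (S k))
      fun k i k' => by rw [iterate_update_index]
  have hstep := Finset.expect_le_expect (s := Finset.univ) fun i _ =>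
    sq_norm_iterate_succ_sub_le hf hcv hc hconv hη hy S i t
  rwa [Finset.expect_add_distrib, Finset.expect_add_distrib, ← Finset.mul_expect,
    ← Finset.mul_expect, Finset.expect_sub_distrib, hfresh_y, hfresh_iterate] at hstep

theorem sum_sq_mul_expect_empiricalRisk_iterate_le [NeZero n] (hf : IsSmoothLoss L f)
    (hcv : ∀ z, ConvexOn ℝ Set.univ fun w => f w z) (hc : IsClosed Ω) (hconv : Convex ℝ Ω)
    (hη : ∀ t, 0 ≤ η t) (hanti : Antitone η) (hηL : ∀ t, η t ≤ 1 / (2 * L)) (hy : y ∈ Ω)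
    (S : Fin n → Z) :
    ∑ t, η t ^ 2 * 𝔼 i, empiricalRisk f S (iterate f Ω η S i t.castSucc)
      ≤ ‖y‖ ^ 2 / (2 * L) + 2 * (∑ t, η t ^ 2) * empiricalRisk f S y := by
  have hsum := sum_sq_mul_le_of_descent (D := fun m => 𝔼 i, ‖iterate f Ω η S i m - y‖ ^ 2) hf.pos
    hη hanti hηL (fun _ => Finset.expect_nonneg fun _ _ => sq_nonneg _)
    (fun _ => Finset.expect_nonneg fun _ _ => empiricalRisk_nonneg hf S _)
    (expect_sq_norm_iterate_succ_sub_le hf hcv hc hconv hη hy S)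
  simpa only [iterate_zero, zero_sub, norm_neg, Fintype.expect_const] using hsum

theorem expect_empiricalRisk_average_le [NeZero n] [NeZero T] (hf : IsSmoothLoss L f)
    (hcv : ∀ z, ConvexOn ℝ Set.univ fun w => f w z) (hc : IsClosed Ω) (hconv : Convex ℝ Ω)
    (hη : ∀ t, 0 < η t) (hanti : Antitone η) (hηL : ∀ t, η t ≤ 1 / (2 * L)) (hy : y ∈ Ω)
    (S : Fin n → Z) :
    𝔼 i, empiricalRisk f S (average f Ω η S i)
      ≤ (∑ t, η t)⁻¹ * (‖y‖ ^ 2 + (∑ t, η t + 2 * L * ∑ t, η t ^ 2) * empiricalRisk f S y) := by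
  have hsum := sum_mul_le_of_descent (D := fun m => 𝔼 i, ‖iterate f Ω η S i m - y‖ ^ 2) hf.pos
    (fun t => (hη t).le) hanti hηL (fun _ => Finset.expect_nonneg fun _ _ => sq_nonneg _)
    (fun _ => Finset.expect_nonneg fun _ _ => empiricalRisk_nonneg hf S _)
    (expect_sq_norm_iterate_succ_sub_le hf hcv hc hconv (fun t => (hη t).le) hy S)
  simp only [iterate_zero, zero_sub, norm_neg, Fintype.expect_const] at hsum
  calc 𝔼 i, empiricalRisk f S (average f Ω η S i)
      ≤ 𝔼 i, (∑ t, η t)⁻¹ * ∑ t, η t * empiricalRisk f S (iterate f Ω η S i t.castSucc) :=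
        Finset.expect_le_expect fun i _ =>
          map_weighted_average_le hη (convexOn_empiricalRisk hcv S) _
    _ = (∑ t, η t)⁻¹ * ∑ t, η t * 𝔼 i, empiricalRisk f S (iterate f Ω η S i t.castSucc) := by
        simp only [← Finset.mul_expect, Finset.expect_sum_comm]
    _ ≤ _ := mul_le_mul_of_nonneg_left hsum
        (inv_nonneg.2 (Finset.sum_nonneg fun t _ => (hη t).le))

theorem expect_sum_sq_mul_expect_loss_iterate (S : Fin n → Z) :
    𝔼 k, ∑ t, η t ^ 2 * 𝔼 i, f (iterate f Ω η S i t.castSucc) (S k)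
      = ∑ t, η t ^ 2 * 𝔼 i, empiricalRisk f S (iterate f Ω η S i t.castSucc) := by
  simp only [empiricalRisk, Finset.expect_sum_comm, ← Finset.mul_expect]
  exact Finset.sum_congr rfl fun t _ => by rw [Finset.expect_comm]

end Optimization

section Stability

variable {S S' : Fin n → Z} {k : Fin n}

theorem sq_norm_iterate_succ_sub_iterate_succ_le (hf : IsSmoothLoss L f)
    (hcv : ∀ z, ConvexOn ℝ Set.univ fun w => f w z) (hc : IsClosed Ω) (hconv : Convex ℝ Ω)
    (hne : Ω.Nonempty) (hη : ∀ t, 0 ≤ η t) (hηL : ∀ t, η t ≤ 1 / (2 * L)) (hp : 0 < p)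
    (hS : ∀ l, l ≠ k → S l = S' l) (i : Fin T → Fin n) (t : Fin T) :
    ‖iterate f Ω η S i t.succ - iterate f Ω η S' i t.succ‖ ^ 2
      ≤ ‖iterate f Ω η S i t.castSucc - iterate f Ω η S' i t.castSucc‖ ^ 2
        + if i t = k then
          p * ‖iterate f Ω η S i t.castSucc - iterate f Ω η S' i t.castSucc‖ ^ 2
          + (1 + 1 / p) * (4 * L * η t ^ 2 * (f (iterate f Ω η S i t.castSucc) (S k)
            + f (iterate f Ω η S' i t.castSucc) (S' k))) else 0 := by
  have hL := hf.pos
  have hstep : η t * L ≤ 2 := by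
    have := hηL t
    rw [le_div_iff₀ (by positivity)] at this
    linarith
  rw [iterate_succ, iterate_succ]
  split_ifs with hit
  · rw [hit, ← add_assoc, ← one_add_mul]
    exact sq_norm_proj_step_sub_proj_step_le hL (hη t) hp (hf.smooth _) (hf.smooth _)
      (hf.nonneg _) (hf.nonneg _) hc hconv hne _ _
  · rw [hS _ hit, add_zero]
    gcongr
    exact norm_proj_step_sub_proj_step_le hL (hη t) hstep (hf.smooth _) (hcv _) hc hconv hne _ _

-- Young's parameter is taken to be `n / T`, so that the growth factor per step is `1 + 1 / T`.
theorem expect_sq_norm_iterate_succ_sub_iterate_succ_le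
    (hf : IsSmoothLoss L f) (hcv : ∀ z, ConvexOn ℝ Set.univ fun w => f w z) (hc : IsClosed Ω)
    (hconv : Convex ℝ Ω) (hne : Ω.Nonempty) (hη : ∀ t, 0 ≤ η t) (hηL : ∀ t, η t ≤ 1 / (2 * L))
    (hS : ∀ l, l ≠ k → S l = S' l) (t : Fin T) :
    𝔼 i, ‖iterate f Ω η S i t.succ - iterate f Ω η S' i t.succ‖ ^ 2
      ≤ (1 + 1 / T) * 𝔼 i, ‖iterate f Ω η S i t.castSucc - iterate f Ω η S' i t.castSucc‖ ^ 2
        + 4 * L * (1 + (T : ℝ) / n) / n * (η t ^ 2 *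
          𝔼 i, (f (iterate f Ω η S i t.castSucc) (S k)
            + f (iterate f Ω η S' i t.castSucc) (S' k))) := by
  have hn : (0 : ℝ) < n := Nat.cast_pos.2 k.pos
  have hT : (0 : ℝ) < T := Nat.cast_pos.2 t.pos
  have hstep := Finset.expect_le_expect (s := Finset.univ) fun i _ =>
    sq_norm_iterate_succ_sub_iterate_succ_le hf hcv hc hconv hne hη hηL (div_pos hn hT) hS i t
  rw [Finset.expect_add_distrib, expect_ite_apply_eq _ _ _
    fun i k' => by rw [iterate_update_index, iterate_update_index], Finset.expect_add_distrib,
    ← Finset.mul_expect, ← Finset.mul_expect, ← Finset.mul_expect, Fintype.card_fin] at hstep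
  refine hstep.trans_eq ?_
  field_simp
  ring

theorem expect_sq_norm_iterate_sub_iterate_le (hf : IsSmoothLoss L f)
    (hcv : ∀ z, ConvexOn ℝ Set.univ fun w => f w z) (hc : IsClosed Ω) (hconv : Convex ℝ Ω)
    (hne : Ω.Nonempty) (hη : ∀ t, 0 ≤ η t) (hηL : ∀ t, η t ≤ 1 / (2 * L))
    (hS : ∀ l, l ≠ k → S l = S' l) (t : Fin T) :
    𝔼 i, ‖iterate f Ω η S i t.castSucc - iterate f Ω η S' i t.castSucc‖ ^ 2
      ≤ 12 * L * (1 + (T : ℝ) / n) / n * ∑ s, η s ^ 2 *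
        𝔼 i, (f (iterate f Ω η S i s.castSucc) (S k)
          + f (iterate f Ω η S' i s.castSucc) (S' k)) := by
  have hL := hf.pos
  set A : Fin T → ℝ := fun s => η s ^ 2 * 𝔼 i, (f (iterate f Ω η S i s.castSucc) (S k)
    + f (iterate f Ω η S' i s.castSucc) (S' k))
  have hA : ∀ s, 0 ≤ A s := fun s => mul_nonneg (sq_nonneg _) <|
    Finset.expect_nonneg fun i _ => add_nonneg (hf.nonneg _ _) (hf.nonneg _ _)
  have hgronwall := castSucc_le_of_le_one_add_mul_add
    (D := fun m => 𝔼 i, ‖iterate f Ω η S i m - iterate f Ω η S' i m‖ ^ 2)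
    (c := 1 / T) (b := fun s => 4 * L * (1 + (T : ℝ) / n) / n * A s) (by positivity)
    (fun _ => Finset.expect_nonneg fun _ _ => sq_nonneg _)
    (fun s => mul_nonneg (by positivity) (hA s))
    (expect_sq_norm_iterate_succ_sub_iterate_succ_le hf hcv hc hconv hne hη hηL hS) t
  have hexp : Real.exp (T * (1 / T)) ≤ 3 := by
    rw [mul_one_div_cancel (Nat.cast_ne_zero.2 t.pos.ne')]
    exact Real.exp_one_lt_three.le
  simp only [iterate_zero, sub_self, norm_zero, zero_pow two_ne_zero, Finset.expect_const_zero,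
    zero_add, ← Finset.mul_sum] at hgronwall
  refine hgronwall.trans ((mul_le_mul_of_nonneg_left hexp ?_).trans_eq (by ring))
  exact mul_nonneg (by positivity) (Finset.sum_nonneg fun s _ => hA s)

theorem sq_norm_average_sub_average_le [NeZero T] (hη : ∀ t, 0 < η t) (i : Fin T → Fin n) :
    ‖average f Ω η S i - average f Ω η S' i‖ ^ 2
      ≤ (∑ t, η t)⁻¹ * ∑ t, η t *
        ‖iterate f Ω η S i t.castSucc - iterate f Ω η S' i t.castSucc‖ ^ 2 := by
  simp only [average, ← smul_sub, ← Finset.sum_sub_distrib]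
  exact map_weighted_average_le hη convexOn_sq_norm _

theorem expect_sq_norm_average_sub_average_le [NeZero T] (hf : IsSmoothLoss L f)
    (hcv : ∀ z, ConvexOn ℝ Set.univ fun w => f w z) (hc : IsClosed Ω) (hconv : Convex ℝ Ω)
    (hne : Ω.Nonempty) (hη : ∀ t, 0 < η t) (hηL : ∀ t, η t ≤ 1 / (2 * L))
    (hS : ∀ l, l ≠ k → S l = S' l) :
    𝔼 i, ‖average f Ω η S i - average f Ω η S' i‖ ^ 2
      ≤ 12 * L * (1 + (T : ℝ) / n) / n * ∑ t, η t ^ 2 *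
        𝔼 i, (f (iterate f Ω η S i t.castSucc) (S k)
          + f (iterate f Ω η S' i t.castSucc) (S' k)) := by
  have hs : 0 < ∑ t, η t := Finset.sum_pos (fun t _ => hη t) Finset.univ_nonempty
  refine (Finset.expect_le_expect fun i _ => sq_norm_average_sub_average_le hη i).trans ?_
  simp only [← Finset.mul_expect, Finset.expect_sum_comm]
  rw [inv_mul_le_iff₀ hs, Finset.sum_mul]
  exact Finset.sum_le_sum fun t _ => mul_le_mul_of_nonneg_left
    (expect_sq_norm_iterate_sub_iterate_le hf hcv hc hconv hne (fun t => (hη t).le) hηL hS t)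
    (hη t).le

end Stability

end Iterates

section Integrability

variable {d : ℕ} {Z : Type*} [MeasurableSpace Z] {f : EuclideanSpace ℝ (Fin d) → Z → ℝ} {L : ℝ}

theorem measurable_uncurry_loss (hf : IsSmoothLoss L f) (hm : ∀ w, Measurable (f w)) :
    Measurable fun p : EuclideanSpace ℝ (Fin d) × Z => f p.1 p.2 :=
  measurable_uncurry_of_continuous_of_measurable (fun z => (hf.smooth z).1.continuous) hm

theorem measurable_fderiv_loss_apply (hf : IsSmoothLoss L f) (hm : ∀ w, Measurable (f w))
    (w u : EuclideanSpace ℝ (Fin d)) : Measurable fun z => fderiv ℝ (fun v => f v z) w u := by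
  refine measurable_of_tendsto_metrizable
    (f := fun (m : ℕ) z => (m : ℝ) • (f (w + (m : ℝ)⁻¹ • u) z - f w z))
    (fun m => ((hm _).sub (hm _)).fun_const_smul _) (tendsto_pi_nhds.2 fun z => ?_)
  exact ((hf.smooth z).1 w).hasFDerivAt.lim u (by simpa using tendsto_natCast_atTop_atTop)

theorem measurable_gradient_loss (hf : IsSmoothLoss L f) (hm : ∀ w, Measurable (f w))
    (w : EuclideanSpace ℝ (Fin d)) : Measurable fun z => ∇ (fun v => f v z) w := by
  have hcoord : ∀ z j, ∇ (fun v => f v z) w j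
      = fderiv ℝ (fun v => f v z) w (EuclideanSpace.single j 1) := fun z j => by
    rw [← inner_gradient_left, EuclideanSpace.inner_single_right]
    simp
  have hofLp : Measurable fun z => WithLp.ofLp (∇ (fun v => f v z) w) :=
    measurable_pi_iff.2 fun j => by
      simpa only [hcoord] using measurable_fderiv_loss_apply hf hm w (EuclideanSpace.single j 1)
  exact (WithLp.measurable_toLp 2 (Fin d → ℝ)).comp hofLp

theorem measurable_uncurry_gradient_loss (hf : IsSmoothLoss L f) (hm : ∀ w, Measurable (f w)) :
    Measurable fun p : EuclideanSpace ℝ (Fin d) × Z => ∇ (fun v => f v p.2) p.1 :=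
  measurable_uncurry_of_continuous_of_measurable (u := fun w z => ∇ (fun v => f v z) w)
    (fun z => (LipschitzWith.of_dist_le_mul (K := ⟨L, hf.pos.le⟩) fun x y => by
      rw [dist_eq_norm, dist_eq_norm]
      exact (hf.smooth z).2 x y).continuous)
    (measurable_gradient_loss hf hm)

variable {X : Type*} [MeasurableSpace X] {μ : Measure X} [IsFiniteMeasure μ]
  {W : X → EuclideanSpace ℝ (Fin d)} {ζ : X → Z} {y : EuclideanSpace ℝ (Fin d)}

theorem integrable_loss_comp (hf : IsSmoothLoss L f) (hm : ∀ w, Measurable (f w))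
    (hW : MemLp W 2 μ) (hζ : Measurable ζ) (hy : Integrable (fun x => f y (ζ x)) μ) :
    Integrable (fun x => f (W x) (ζ x)) μ := by
  have hdist : Integrable (fun x => ‖W x - y‖ ^ 2) μ :=
    (hW.sub (memLp_const y)).integrable_norm_pow two_ne_zero
  refine ((hy.const_mul (1 + L / L)).add (hdist.const_mul ((L + L) / 2))).mono'
    ((measurable_uncurry_loss hf hm).comp_aemeasurable
      (hW.1.aemeasurable.prodMk hζ.aemeasurable)).aestronglyMeasurable
    (Filter.Eventually.of_forall fun x => ?_)
  rw [Real.norm_of_nonneg (hf.nonneg _ _)]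
  exact le_one_add_mul_add_sq_norm hf.pos hf.pos (hf.smooth _).1 (hf.smooth _).2 (hf.nonneg _) y _

theorem memLp_two_gradient_loss_comp (hf : IsSmoothLoss L f) (hm : ∀ w, Measurable (f w))
    (hW : MemLp W 2 μ) (hζ : Measurable ζ) (hy : Integrable (fun x => f y (ζ x)) μ) :
    MemLp (fun x => ∇ (fun v => f v (ζ x)) (W x)) 2 μ := by
  have hmeas : AEStronglyMeasurable (fun x => ∇ (fun v => f v (ζ x)) (W x)) μ :=
    ((measurable_uncurry_gradient_loss hf hm).comp_aemeasurable
      (hW.1.aemeasurable.prodMk hζ.aemeasurable)).aestronglyMeasurable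
  rw [memLp_two_iff_integrable_sq_norm hmeas]
  refine ((integrable_loss_comp hf hm hW hζ hy).const_mul (2 * L)).mono' (hmeas.norm.pow 2)
    (Filter.Eventually.of_forall fun x => ?_)
  rw [Real.norm_of_nonneg (sq_nonneg _)]
  exact sq_norm_gradient_le hf.pos (hf.smooth _).1 (hf.smooth _).2 (hf.nonneg _) _

theorem memLp_proj_comp {Ω : Set (EuclideanSpace ℝ (Fin d))} (hc : IsClosed Ω)
    (hconv : Convex ℝ Ω) (hne : Ω.Nonempty) {p : ENNReal} (hW : MemLp W p μ) :
    MemLp (fun x => proj Ω (W x)) p μ := by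
  obtain ⟨a, ha⟩ := hne
  have hmeas : AEStronglyMeasurable (fun x => proj Ω (W x)) μ :=
    (lipschitzWith_proj hc hconv ⟨a, ha⟩).continuous.comp_aestronglyMeasurable hW.1
  have hdist : MemLp (fun x => proj Ω (W x) - a) p μ :=
    (hW.sub (memLp_const a)).of_le (hmeas.sub aestronglyMeasurable_const)
      (Filter.Eventually.of_forall fun x => norm_proj_sub_le hc hconv ha (W x))
  simpa [Pi.add_def] using hdist.add (memLp_const a)

end Integrability

/-- The law of a sample `S = (z_1, …, z_n)` of `n` independent draws from `ρ`. -/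
abbrev sampleLaw {Z : Type*} [MeasurableSpace Z] (ρ : Measure Z) (n : ℕ) : Measure (Fin n → Z) :=
  Measure.pi fun _ => ρ

section IntegrableIterates

variable {d n T : ℕ} {Z : Type*} [MeasurableSpace Z] {ρ : Measure Z} [IsProbabilityMeasure ρ]
  {f : EuclideanSpace ℝ (Fin d) → Z → ℝ} {Ω : Set (EuclideanSpace ℝ (Fin d))} {η : Fin T → ℝ}
  {L : ℝ} {y : EuclideanSpace ℝ (Fin d)}

theorem memLp_iterate (hf : IsSmoothLoss L f) (hm : ∀ w, Measurable (f w))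
    (hint : Integrable (f y) ρ) (hc : IsClosed Ω) (hconv : Convex ℝ Ω) (hne : Ω.Nonempty)
    (i : Fin T → Fin n) (m : Fin (T + 1)) :
    MemLp (fun S => iterate f Ω η S i m) 2 (sampleLaw ρ n) := by
  induction m using Fin.induction with
  | zero => simpa only [iterate_zero] using memLp_const 0
  | succ t ih =>
    simp only [iterate_succ]
    exact memLp_proj_comp hc hconv hne (ih.sub ((memLp_two_gradient_loss_comp hf hm ih
      (measurable_pi_apply (i t)) (integrable_comp_eval hint)).const_smul (η t)))

theorem memLp_average (hf : IsSmoothLoss L f) (hm : ∀ w, Measurable (f w))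
    (hint : Integrable (f y) ρ) (hc : IsClosed Ω) (hconv : Convex ℝ Ω) (hne : Ω.Nonempty)
    (i : Fin T → Fin n) : MemLp (fun S => average f Ω η S i) 2 (sampleLaw ρ n) := by
  have hterm : ∀ t ∈ Finset.univ, MemLp (fun S => η t • iterate f Ω η S i t.castSucc) 2
      (sampleLaw ρ n) := fun t _ =>
    (memLp_iterate hf hm hint hc hconv hne i t.castSucc).const_smul (η t)
  exact (memLp_finsetSum Finset.univ hterm).const_smul (∑ t, η t)⁻¹

end IntegrableIterates

theorem integrable_prod_of_finite {X κ : Type*} [MeasurableSpace X] {μ : Measure X} [Finite κ]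
    [MeasurableSpace κ] [MeasurableSingletonClass κ]
    {ν : Measure κ} [IsFiniteMeasure ν] [SFinite μ] {g : X × κ → ℝ}
    (hg : ∀ i, Integrable (fun x => g (x, i)) μ) : Integrable g (μ.prod ν) := by
  classical
  cases nonempty_fintype κ
  have hsum : g = fun x => ∑ i, g (x.1, i) * (Pi.single i 1 : κ → ℝ) x.2 := by
    funext x
    simp [Pi.single_apply]
  rw [hsum]
  exact integrable_finsetSum _ fun i _ => (hg i).mul_prod Integrable.of_finite

section FiniteRandomness

variable {X κ : Type*} [MeasurableSpace X] {μ : Measure X} [Fintype κ]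

theorem integrable_expect {g : κ → X → ℝ} (hg : ∀ i, Integrable (g i) μ) :
    Integrable (fun x => 𝔼 i, g i x) μ := by
  simp only [Fintype.expect_eq_sum_div_card]
  exact (integrable_finsetSum _ fun i _ => hg i).div_const _

theorem integral_expect {g : κ → X → ℝ} (hg : ∀ i, Integrable (g i) μ) :
    ∫ x, 𝔼 i, g i x ∂μ = 𝔼 i, ∫ x, g i x ∂μ := by
  simp only [Fintype.expect_eq_sum_div_card]
  rw [integral_div, integral_finsetSum _ fun i _ => hg i]

variable {Z : Type*} [MeasurableSpace Z] {ρ : Measure Z} [IsProbabilityMeasure ρ] {n T : ℕ}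
  {g : (Fin n → Z) × (Fin T → Fin n) → ℝ}

theorem integrable_law (hg : ∀ i, Integrable (fun S => g (S, i)) (sampleLaw ρ n)) :
    Integrable g (law ρ n T) :=
  integrable_prod_of_finite hg

theorem integral_law (hg : ∀ i, Integrable (fun S => g (S, i)) (sampleLaw ρ n)) :
    ∫ x, g x ∂law ρ n T = 𝔼 i, ∫ S, g (S, i) ∂sampleLaw ρ n := by
  have hweight : ∀ i : Fin T → Fin n, (Measure.pi fun _ : Fin T =>
      ProbabilityTheory.uniformOn (Set.univ : Set (Fin n))).real {i}
      = (Fintype.card (Fin T → Fin n) : ℝ)⁻¹ := fun i => by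
    simp [Measure.real, Measure.pi_singleton, ProbabilityTheory.uniformOn_univ]
  have hint := integrable_law hg
  rw [law] at hint ⊢
  rw [integral_prod_symm _ hint, integral_fintype Integrable.of_finite]
  simp only [hweight, smul_eq_mul, ← Finset.mul_sum]
  rw [Fintype.expect_eq_sum_div_card, div_eq_inv_mul]

end FiniteRandomness

section Swap

variable {Z : Type*} [MeasurableSpace Z] {n : ℕ}

/-- Exchange of the `k`-th data point with an additional one. -/
def swapPoint (k : Fin n) : (Fin n → Z) × Z ≃ᵐ (Fin n → Z) × Z :=
  MeasurableEquiv.ofInvolutive (fun x => (Function.update x.1 k x.2, x.1 k))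
    (fun x => by simp)
    ((measurable_pi_iff.2 fun l => by
      rcases eq_or_ne l k with rfl | hlk
      · simpa using measurable_snd
      · simp only [Function.update_of_ne hlk]
        exact (measurable_pi_apply l).comp measurable_fst).prodMk
      ((measurable_pi_apply k).comp measurable_fst))

theorem swapPoint_apply (k : Fin n) (x : (Fin n → Z) × Z) :
    swapPoint k x = (Function.update x.1 k x.2, x.1 k) := rfl

theorem measurePreserving_swapPoint (ρ : Measure Z) [IsProbabilityMeasure ρ] (k : Fin n) :
    MeasurePreserving (swapPoint (Z := Z) k) ((sampleLaw ρ n).prod ρ)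
      ((sampleLaw ρ n).prod ρ) := by
  cases n with
  | zero => exact k.elim0
  | succ m =>
    have hsplit := measurePreserving_piFinSuccAbove (fun _ : Fin (m + 1) => ρ) k
    have hpull := hsplit.prod (MeasurePreserving.id ρ)
    have hassoc := measurePreserving_prodAssoc ρ (sampleLaw ρ m) ρ
    have hrotate := Measure.measurePreserving_swap (μ := ρ) (ν := (sampleLaw ρ m).prod ρ)
    have hswap := (Measure.measurePreserving_swap (μ := sampleLaw ρ m) (ν := ρ)).prod
      (MeasurePreserving.id ρ)
    have hpush := hsplit.symm.prod (MeasurePreserving.id ρ)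
    convert hpush.comp (hswap.comp (hrotate.comp (hassoc.comp hpull))) using 1
    funext x
    simp only [Function.comp_apply, Prod.map, id, swapPoint_apply, MeasurableEquiv.prodAssoc,
      MeasurableEquiv.piFinSuccAbove_symm_apply, MeasurableEquiv.piFinSuccAbove_apply]
    refine Prod.ext ?_ rfl
    exact (Fin.insertNth_removeNth k x.2 x.1).symm

theorem measurePreserving_update (ρ : Measure Z) [IsProbabilityMeasure ρ] (k : Fin n) :
    MeasurePreserving (fun x : (Fin n → Z) × Z => Function.update x.1 k x.2)
      ((sampleLaw ρ n).prod ρ) (sampleLaw ρ n) :=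
  measurePreserving_fst.comp (measurePreserving_swapPoint ρ k)

theorem integrable_add_comp_update {ρ : Measure Z} [IsProbabilityMeasure ρ]
    {h : (Fin n → Z) → ℝ} (hh : Integrable h (sampleLaw ρ n)) (k : Fin n) :
    Integrable (fun x : (Fin n → Z) × Z => h x.1 + h (Function.update x.1 k x.2))
      ((sampleLaw ρ n).prod ρ) :=
  (hh.comp_fst ρ).add ((measurePreserving_update ρ k).integrable_comp_of_integrable hh)

theorem integral_add_comp_update {ρ : Measure Z} [IsProbabilityMeasure ρ]
    {h : (Fin n → Z) → ℝ} (hh : Integrable h (sampleLaw ρ n)) (k : Fin n) :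
    ∫ x : (Fin n → Z) × Z, (h x.1 + h (Function.update x.1 k x.2)) ∂(sampleLaw ρ n).prod ρ
      = 2 * ∫ S, h S ∂sampleLaw ρ n := by
  have hint : Integrable (fun x : (Fin n → Z) × Z => h (Function.update x.1 k x.2))
      ((sampleLaw ρ n).prod ρ) := (measurePreserving_update ρ k).integrable_comp_of_integrable hh
  have hfst : ∫ x : (Fin n → Z) × Z, h x.1 ∂(sampleLaw ρ n).prod ρ = ∫ S, h S ∂sampleLaw ρ n := by
    rw [integral_fun_fst, probReal_univ, one_smul]
  have hupdate : ∫ x : (Fin n → Z) × Z, h (Function.update x.1 k x.2) ∂(sampleLaw ρ n).prod ρ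
      = ∫ x : (Fin n → Z) × Z, h x.1 ∂(sampleLaw ρ n).prod ρ :=
    (measurePreserving_swapPoint ρ k).integral_comp' fun x => h x.1
  rw [integral_add (hh.comp_fst ρ) hint, hupdate, hfst, two_mul]

end Swap

/-- The `ℓ₂` on-average model stability of the algorithm `W`: the mean squared displacement of its
output when a uniformly chosen point of the sample is replaced by an independent copy. For a
randomized algorithm it is taken for each value of the internal randomness, and then averaged. -/
def onAverageStability {d n : ℕ} {Z : Type*} [MeasurableSpace Z] (ρ : Measure Z)
    (W : (Fin n → Z) → EuclideanSpace ℝ (Fin d)) : ℝ :=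
  𝔼 k, ∫ x, ‖W x.1 - W (Function.update x.1 k x.2)‖ ^ 2 ∂(sampleLaw ρ n).prod ρ

section Generalization

variable {d n : ℕ} {Z : Type*} [MeasurableSpace Z] {ρ : Measure Z} [IsProbabilityMeasure ρ]
  {f : EuclideanSpace ℝ (Fin d) → Z → ℝ} {L γ : ℝ} {y : EuclideanSpace ℝ (Fin d)}
  {W : (Fin n → Z) → EuclideanSpace ℝ (Fin d)}

theorem integrable_loss_sample (hf : IsSmoothLoss L f) (hm : ∀ w, Measurable (f w))
    (hint : Integrable (f y) ρ) (hW : MemLp W 2 (sampleLaw ρ n)) (k : Fin n) :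
    Integrable (fun S => f (W S) (S k)) (sampleLaw ρ n) :=
  integrable_loss_comp hf hm hW (measurable_pi_apply k) (integrable_comp_eval hint)

theorem integrable_empiricalRisk (hf : IsSmoothLoss L f) (hm : ∀ w, Measurable (f w))
    (hint : Integrable (f y) ρ) (hW : MemLp W 2 (sampleLaw ρ n)) :
    Integrable (fun S => empiricalRisk f S (W S)) (sampleLaw ρ n) :=
  integrable_expect fun k => integrable_loss_sample hf hm hint hW k

theorem integrable_loss_fresh (hf : IsSmoothLoss L f) (hm : ∀ w, Measurable (f w))
    (hint : Integrable (f y) ρ) (hW : MemLp W 2 (sampleLaw ρ n)) :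
    Integrable (fun x : (Fin n → Z) × Z => f (W x.1) x.2) ((sampleLaw ρ n).prod ρ) :=
  integrable_loss_comp hf hm (hW.comp_fst ρ) measurable_snd (hint.comp_snd _)

theorem integrable_risk (hf : IsSmoothLoss L f) (hm : ∀ w, Measurable (f w))
    (hint : Integrable (f y) ρ) (hW : MemLp W 2 (sampleLaw ρ n)) :
    Integrable (fun S => risk ρ f (W S)) (sampleLaw ρ n) :=
  (integrable_loss_fresh hf hm hint hW).integral_prod_left

theorem integrable_sq_norm_sub_comp_update (hW : MemLp W 2 (sampleLaw ρ n)) (k : Fin n) :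
    Integrable (fun x : (Fin n → Z) × Z => ‖W x.1 - W (Function.update x.1 k x.2)‖ ^ 2)
      ((sampleLaw ρ n).prod ρ) :=
  ((hW.comp_fst ρ).sub (hW.comp_measurePreserving
    (measurePreserving_update ρ k))).integrable_norm_pow two_ne_zero

theorem integral_risk_eq_integral_update (hf : IsSmoothLoss L f) (hm : ∀ w, Measurable (f w))
    (hint : Integrable (f y) ρ) (hW : MemLp W 2 (sampleLaw ρ n)) (k : Fin n) :
    ∫ S, risk ρ f (W S) ∂sampleLaw ρ n
      = ∫ x, f (W (Function.update x.1 k x.2)) (x.1 k) ∂(sampleLaw ρ n).prod ρ :=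
  (integral_prod _ (integrable_loss_fresh hf hm hint hW)).symm.trans
    ((measurePreserving_swapPoint ρ k).integral_comp' fun x => f (W x.1) x.2).symm

theorem integral_risk_le_integral_loss_add (hf : IsSmoothLoss L f) (hm : ∀ w, Measurable (f w))
    (hint : Integrable (f y) ρ) (hW : MemLp W 2 (sampleLaw ρ n)) (hγ : 0 < γ) (k : Fin n) :
    ∫ S, risk ρ f (W S) ∂sampleLaw ρ n
      ≤ (1 + L / γ) * ∫ S, f (W S) (S k) ∂sampleLaw ρ n
        + (γ + L) / 2 *
          ∫ x, ‖W x.1 - W (Function.update x.1 k x.2)‖ ^ 2 ∂(sampleLaw ρ n).prod ρ := by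
  have hloss := ((integrable_loss_sample hf hm hint hW k).comp_fst ρ).const_mul (1 + L / γ)
  have hdist := (integrable_sq_norm_sub_comp_update hW k).const_mul ((γ + L) / 2)
  have hswapped : Integrable (fun x : (Fin n → Z) × Z => f (W (Function.update x.1 k x.2)) (x.1 k))
      ((sampleLaw ρ n).prod ρ) :=
    (measurePreserving_swapPoint ρ k).integrable_comp_of_integrable
      (integrable_loss_fresh hf hm hint hW)
  have hfst : ∫ x : (Fin n → Z) × Z, f (W x.1) (x.1 k) ∂(sampleLaw ρ n).prod ρ
      = ∫ S, f (W S) (S k) ∂sampleLaw ρ n := by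
    rw [integral_fun_fst fun S : Fin n → Z => f (W S) (S k), probReal_univ, one_smul]
  rw [integral_risk_eq_integral_update hf hm hint hW k, ← hfst, ← integral_const_mul,
    ← integral_const_mul, ← integral_add hloss hdist]
  refine integral_mono hswapped (hloss.add hdist) fun x => ?_
  have hsmooth := le_one_add_mul_add_sq_norm hf.pos hγ (hf.smooth (x.1 k)).1 (hf.smooth (x.1 k)).2
    (hf.nonneg _) (W x.1) (W (Function.update x.1 k x.2))
  rwa [norm_sub_rev] at hsmooth

theorem integral_risk_le_integral_empiricalRisk_add [NeZero n] (hf : IsSmoothLoss L f)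
    (hm : ∀ w, Measurable (f w)) (hint : Integrable (f y) ρ) (hW : MemLp W 2 (sampleLaw ρ n))
    (hγ : 0 < γ) :
    ∫ S, risk ρ f (W S) ∂sampleLaw ρ n
      ≤ (1 + L / γ) * ∫ S, empiricalRisk f S (W S) ∂sampleLaw ρ n
        + (γ + L) / 2 * onAverageStability ρ W := by
  have hmean := Finset.expect_le_expect (s := Finset.univ) fun k _ =>
    integral_risk_le_integral_loss_add hf hm hint hW hγ k
  rwa [Fintype.expect_const, Finset.expect_add_distrib, ← Finset.mul_expect, ← Finset.mul_expect,
    ← integral_expect fun k => integrable_loss_sample hf hm hint hW k] at hmean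

theorem integral_le_of_forall_le_add_mul_empiricalRisk [NeZero n] (hint : Integrable (f y) ρ)
    {X : (Fin n → Z) → ℝ} (hX : Integrable X (sampleLaw ρ n)) {a b : ℝ}
    (hle : ∀ S, X S ≤ a + b * empiricalRisk f S y) :
    ∫ S, X S ∂sampleLaw ρ n ≤ a + b * risk ρ f y := by
  have heval : ∀ k, Integrable (fun S => f y (S k)) (sampleLaw ρ n) := fun k =>
    integrable_comp_eval hint
  have hmean : Integrable (fun S => empiricalRisk f S y) (sampleLaw ρ n) := integrable_expect heval
  have hmarginal : ∀ k : Fin n, ∫ S, f y (S k) ∂sampleLaw ρ n = risk ρ f y := fun k =>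
    integral_comp_eval (μ := fun _ => ρ) hint.aestronglyMeasurable
  have hunbiased : ∫ S, empiricalRisk f S y ∂sampleLaw ρ n = risk ρ f y := by
    simp only [empiricalRisk]
    rw [integral_expect heval]
    simp only [hmarginal, Fintype.expect_const]
  calc ∫ S, X S ∂sampleLaw ρ n
      ≤ ∫ S, (a + b * empiricalRisk f S y) ∂sampleLaw ρ n :=
        integral_mono hX ((integrable_const a).add (hmean.const_mul b)) hle
    _ = a + b * risk ρ f y := by
        rw [integral_add (integrable_const a) (hmean.const_mul b), integral_const,
          integral_const_mul, hunbiased, probReal_univ, one_smul]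

end Generalization

section SGD

variable {d n T : ℕ} {Z : Type*} [MeasurableSpace Z] {ρ : Measure Z} [IsProbabilityMeasure ρ]
  {f : EuclideanSpace ℝ (Fin d) → Z → ℝ} {Ω : Set (EuclideanSpace ℝ (Fin d))} {η : Fin T → ℝ}
  {L γ : ℝ} {y : EuclideanSpace ℝ (Fin d)}

theorem integrable_sum_sq_mul_expect_loss_iterate (hf : IsSmoothLoss L f)
    (hm : ∀ w, Measurable (f w)) (hint : Integrable (f y) ρ) (hc : IsClosed Ω)
    (hconv : Convex ℝ Ω) (hne : Ω.Nonempty) (k : Fin n) :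
    Integrable (fun S => ∑ t, η t ^ 2 * 𝔼 i, f (iterate f Ω η S i t.castSucc) (S k))
      (sampleLaw ρ n) :=
  integrable_finsetSum _ fun t _ => (integrable_expect fun i => integrable_loss_sample hf hm hint
    (memLp_iterate hf hm hint hc hconv hne i t.castSucc) k).const_mul (η t ^ 2)

theorem expect_integral_sq_norm_average_sub_update_le [NeZero T] (hf : IsSmoothLoss L f)
    (hm : ∀ w, Measurable (f w)) (hcv : ∀ z, ConvexOn ℝ Set.univ fun w => f w z)
    (hint : Integrable (f y) ρ) (hc : IsClosed Ω) (hconv : Convex ℝ Ω) (hne : Ω.Nonempty)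
    (hη : ∀ t, 0 < η t) (hηL : ∀ t, η t ≤ 1 / (2 * L)) (k : Fin n) :
    𝔼 i, ∫ x, ‖average f Ω η x.1 i - average f Ω η (Function.update x.1 k x.2) i‖ ^ 2
        ∂(sampleLaw ρ n).prod ρ
      ≤ 24 * L * (1 + (T : ℝ) / n) / n
        * ∫ S, ∑ t, η t ^ 2 * 𝔼 i, f (iterate f Ω η S i t.castSucc) (S k) ∂sampleLaw ρ n := by
  have hdist := fun i : Fin T → Fin n => integrable_sq_norm_sub_comp_update
    (memLp_average (η := η) hf hm hint hc hconv hne i) k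
  have hloss := integrable_sum_sq_mul_expect_loss_iterate (η := η) hf hm hint hc hconv hne k
  rw [← integral_expect hdist]
  refine (integral_mono (integrable_expect hdist) ((integrable_add_comp_update hloss k).const_mul
    (12 * L * (1 + (T : ℝ) / n) / n)) fun x => ?_).trans_eq ?_
  · have hswap := expect_sq_norm_average_sub_average_le hf hcv hc hconv hne hη hηL
      (S := x.1) (S' := Function.update x.1 k x.2) (k := k)
      fun l hl => (Function.update_of_ne hl _ _).symm
    simpa only [Finset.expect_add_distrib, mul_add, Finset.sum_add_distrib] using hswap
  · rw [integral_const_mul, integral_add_comp_update hloss k]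
    ring

theorem expect_onAverageStability_average_le [NeZero n] [NeZero T] (hf : IsSmoothLoss L f)
    (hm : ∀ w, Measurable (f w)) (hcv : ∀ z, ConvexOn ℝ Set.univ fun w => f w z)
    (hint : Integrable (f y) ρ) (hc : IsClosed Ω) (hconv : Convex ℝ Ω) (hη : ∀ t, 0 < η t)
    (hanti : Antitone η) (hηL : ∀ t, η t ≤ 1 / (2 * L)) (hy : y ∈ Ω) :
    𝔼 i : Fin T → Fin n, onAverageStability ρ (fun S => average f Ω η S i)
      ≤ 24 * L * (1 + (T : ℝ) / n) / n
        * (‖y‖ ^ 2 / (2 * L) + 2 * (∑ t, η t ^ 2) * risk ρ f y) := by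
  have hL := hf.pos
  have hloss := fun k : Fin n =>
    integrable_sum_sq_mul_expect_loss_iterate (η := η) hf hm hint hc hconv ⟨y, hy⟩ k
  calc 𝔼 i : Fin T → Fin n, onAverageStability ρ (fun S => average f Ω η S i)
      = 𝔼 k, 𝔼 i, ∫ x, ‖average f Ω η x.1 i - average f Ω η (Function.update x.1 k x.2) i‖ ^ 2
          ∂(sampleLaw ρ n).prod ρ := Finset.expect_comm ..
    _ ≤ 𝔼 k, 24 * L * (1 + (T : ℝ) / n) / n
          * ∫ S, ∑ t, η t ^ 2 * 𝔼 i, f (iterate f Ω η S i t.castSucc) (S k) ∂sampleLaw ρ n :=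
        Finset.expect_le_expect fun k _ => expect_integral_sq_norm_average_sub_update_le
          hf hm hcv hint hc hconv ⟨y, hy⟩ hη hηL k
    _ = 24 * L * (1 + (T : ℝ) / n) / n
          * ∫ S, 𝔼 k, ∑ t, η t ^ 2 * 𝔼 i, f (iterate f Ω η S i t.castSucc) (S k)
            ∂sampleLaw ρ n := by rw [integral_expect hloss, Finset.mul_expect]
    _ ≤ 24 * L * (1 + (T : ℝ) / n) / n
          * (‖y‖ ^ 2 / (2 * L) + 2 * (∑ t, η t ^ 2) * risk ρ f y) := by
        gcongr
        refine integral_le_of_forall_le_add_mul_empiricalRisk hint (integrable_expect hloss)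
          fun S => ?_
        rw [expect_sum_sq_mul_expect_loss_iterate]
        exact sum_sq_mul_expect_empiricalRisk_iterate_le hf hcv hc hconv (fun t => (hη t).le)
          hanti hηL hy S

theorem expect_integral_empiricalRisk_average_le [NeZero n] [NeZero T] (hf : IsSmoothLoss L f)
    (hm : ∀ w, Measurable (f w)) (hcv : ∀ z, ConvexOn ℝ Set.univ fun w => f w z)
    (hint : Integrable (f y) ρ) (hc : IsClosed Ω) (hconv : Convex ℝ Ω) (hη : ∀ t, 0 < η t)
    (hanti : Antitone η) (hηL : ∀ t, η t ≤ 1 / (2 * L)) (hy : y ∈ Ω) :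
    𝔼 i, ∫ S, empiricalRisk f S (average f Ω η S i) ∂sampleLaw ρ n
      ≤ (∑ t, η t)⁻¹ * (‖y‖ ^ 2 + (∑ t, η t + 2 * L * ∑ t, η t ^ 2) * risk ρ f y) := by
  have hrisk := fun i : Fin T → Fin n => integrable_empiricalRisk hf hm hint
    (memLp_average (η := η) hf hm hint hc hconv ⟨y, hy⟩ i)
  rw [← integral_expect hrisk, mul_add, ← mul_assoc]
  refine integral_le_of_forall_le_add_mul_empiricalRisk hint (integrable_expect hrisk) fun S => ?_
  rw [mul_assoc, ← mul_add]
  exact expect_empiricalRisk_average_le hf hcv hc hconv hη hanti hηL hy S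

theorem expect_integral_risk_average_le [NeZero n] [NeZero T] (hf : IsSmoothLoss L f)
    (hm : ∀ w, Measurable (f w)) (hcv : ∀ z, ConvexOn ℝ Set.univ fun w => f w z)
    (hint : Integrable (f y) ρ) (hc : IsClosed Ω) (hconv : Convex ℝ Ω) (hη : ∀ t, 0 < η t)
    (hanti : Antitone η) (hηL : ∀ t, η t ≤ 1 / (2 * L)) (hy : y ∈ Ω) (hγ : 0 < γ) :
    𝔼 i, ∫ S, risk ρ f (average f Ω η S i) ∂sampleLaw ρ n
      ≤ (1 + L / γ) * ((∑ t, η t)⁻¹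
          * (‖y‖ ^ 2 + (∑ t, η t + 2 * L * ∑ t, η t ^ 2) * risk ρ f y))
        + (γ + L) / 2 * (24 * L * (1 + (T : ℝ) / n) / n
          * (‖y‖ ^ 2 / (2 * L) + 2 * (∑ t, η t ^ 2) * risk ρ f y)) := by
  have hL := hf.pos
  have hgap := Finset.expect_le_expect (s := Finset.univ) fun (i : Fin T → Fin n) _ =>
    integral_risk_le_integral_empiricalRisk_add hf hm hint
      (memLp_average (η := η) hf hm hint hc hconv ⟨y, hy⟩ i) hγ
  rw [Finset.expect_add_distrib, ← Finset.mul_expect, ← Finset.mul_expect] at hgap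
  refine hgap.trans (add_le_add ?_ ?_)
  · gcongr
    exact expect_integral_empiricalRisk_average_le hf hm hcv hint hc hconv hη hanti hηL hy
  · gcongr
    exact expect_onAverageStability_average_le hf hm hcv hint hc hconv hη hanti hηL hy

end SGD

section Constants

/-- The constant of the excess risk bound: `L` is the smoothness of the loss, and `B` bounds the
norm of the comparator. -/
def excessRiskConst (L B : ℝ) : ℝ :=
  (1 + L) * (6 * B ^ 2 + 24 * L + 1)

variable {L B γ b s q F : ℝ}

theorem excessRiskConst_pos (hL : 0 < L) (B : ℝ) : 0 < excessRiskConst L B := by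
  unfold excessRiskConst
  positivity

theorem add_mul_le_mul_one_add {a c K x : ℝ} (ha : a ≤ K) (hc : c ≤ K) (hx : 0 ≤ x) :
    a + c * x ≤ K * (1 + x) := by
  linarith [mul_le_mul_of_nonneg_right hc hx]

theorem optimization_term_le (hL : 0 < L) (hγ : 1 ≤ γ) (hF : 0 ≤ F) (hb : b ^ 2 ≤ B ^ 2)
    (hs : 0 < s) (hq : 0 ≤ q) :
    (1 + L / γ) * (s⁻¹ * (b ^ 2 + (s + 2 * L * q) * F)) - F
      ≤ excessRiskConst L B * ((1 / γ + q / s) * F + 1 / s) := by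
  have hLγ : L / γ ≤ L := div_le_self hL.le hγ
  have hgrowth : b ^ 2 + 2 * L * (q * F) ≤ (6 * B ^ 2 + 24 * L + 1) * (1 + q * F) :=
    add_mul_le_mul_one_add (by linarith [sq_nonneg B]) (by linarith [sq_nonneg B])
      (mul_nonneg hq hF)
  have hself : L ≤ excessRiskConst L B := by
    unfold excessRiskConst
    nlinarith [sq_nonneg B]
  calc (1 + L / γ) * (s⁻¹ * (b ^ 2 + (s + 2 * L * q) * F)) - F
      = L * (1 / γ * F) + (1 + L / γ) * (s⁻¹ * (b ^ 2 + 2 * L * (q * F))) := by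
        field_simp
        ring
    _ ≤ excessRiskConst L B * (1 / γ * F)
        + (1 + L) * (s⁻¹ * ((6 * B ^ 2 + 24 * L + 1) * (1 + q * F))) := by gcongr
    _ = excessRiskConst L B * ((1 / γ + q / s) * F + 1 / s) := by
        rw [excessRiskConst]
        field_simp
        ring

theorem stability_term_le {a : ℝ} (hL : 0 < L) (hγ : 1 ≤ γ) (hF : 0 ≤ F) (hb : b ^ 2 ≤ B ^ 2)
    (hq : 0 ≤ q) (ha : 0 ≤ a) :
    (γ + L) / 2 * (24 * L * a * (b ^ 2 / (2 * L) + 2 * q * F))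
      ≤ excessRiskConst L B * (γ * a * (1 + q * F)) := by
  have hgrowth : 6 * b ^ 2 + 24 * L * (q * F) ≤ (6 * B ^ 2 + 24 * L + 1) * (1 + q * F) :=
    add_mul_le_mul_one_add (by linarith) (by linarith [sq_nonneg B]) (mul_nonneg hq hF)
  have hγL : γ + L ≤ γ * (1 + L) := by nlinarith
  calc (γ + L) / 2 * (24 * L * a * (b ^ 2 / (2 * L) + 2 * q * F))
      = (γ + L) * (a * (6 * b ^ 2 + 24 * L * (q * F))) := by
        field_simp
        ring
    _ ≤ γ * (1 + L) * (a * ((6 * B ^ 2 + 24 * L + 1) * (1 + q * F))) := by gcongr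
    _ = excessRiskConst L B * (γ * a * (1 + q * F)) := by
        rw [excessRiskConst]
        ring

end Constants

end ProjSGD

end

open ProjSGD in
theorem mainTheorem3_general {L B γ : ℝ} {d n T : ℕ} {Z : Type*}
    [MeasurableSpace Z] {ρ : Measure Z} [IsProbabilityMeasure ρ]
    {f : EuclideanSpace ℝ (Fin d) → Z → ℝ} {Ω : Set (EuclideanSpace ℝ (Fin d))}
    {y : EuclideanSpace ℝ (Fin d)} {η : Fin T → ℝ} (hf : IsSmoothLoss L f)
    (hm : ∀ w, Measurable (f w)) (hcv : ∀ z, ConvexOn ℝ Set.univ fun w => f w z)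
    (hc : IsClosed Ω) (hconv : Convex ℝ Ω) (hy : y ∈ Ω) (hint : Integrable (f y) ρ)
    (hB : ‖y‖ ≤ B) (hn : 0 < n) (hT : 0 < T) (hη : ∀ t, 0 < η t) (hanti : Antitone η)
    (hηL : ∀ t, η t ≤ 1 / (2 * L)) (hγ : 1 ≤ γ) :
    Integrable (fun ω => risk ρ f (average f Ω η ω.1 ω.2)) (law ρ n T) ∧
      (∫ ω, risk ρ f (average f Ω η ω.1 ω.2) ∂law ρ n T) - risk ρ f y
        ≤ excessRiskConst L B * ((1 / γ + (∑ t, η t ^ 2) / (∑ t, η t)) * risk ρ f y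
            + 1 / (∑ t, η t)
            + γ * (1 + (T : ℝ) / n) / n * (1 + (∑ t, η t ^ 2) * risk ρ f y)) := by
  have : NeZero n := ⟨hn.ne'⟩
  have : NeZero T := ⟨hT.ne'⟩
  have hrisk := fun i : Fin T → Fin n => integrable_risk hf hm hint
    (memLp_average (η := η) hf hm hint hc hconv ⟨y, hy⟩ i)
  refine ⟨integrable_law hrisk, ?_⟩
  have hbound := expect_integral_risk_average_le (n := n) hf hm hcv hint hc hconv hη hanti hηL hy
    (zero_lt_one.trans_le hγ)
  have hF : 0 ≤ risk ρ f y := integral_nonneg fun z => hf.nonneg z y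
  have hyB : ‖y‖ ^ 2 ≤ B ^ 2 := pow_le_pow_left₀ (norm_nonneg y) hB 2
  have hs : 0 < ∑ t, η t := Finset.sum_pos (fun t _ => hη t) Finset.univ_nonempty
  have hq : 0 ≤ ∑ t, η t ^ 2 := Finset.sum_nonneg fun t _ => sq_nonneg (η t)
  have hopt := optimization_term_le hf.pos hγ hF hyB hs hq
  have hstab := stability_term_le (a := (1 + (T : ℝ) / n) / n) hf.pos hγ hF hyB hq (by positivity)
  rw [integral_law hrisk]
  rw [mul_div_assoc] at hbound ⊢
  linarith

theorem mainTheorem3 (L : ℝ) (hL : 0 < L) (B : ℝ) :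
    ∃ C : ℝ, 0 < C ∧
      ∀ (d : ℕ) (Z : Type*) [MeasurableSpace Z] (ρ : Measure Z) [IsProbabilityMeasure ρ]
        (f : EuclideanSpace ℝ (Fin d) → Z → ℝ) (Ω : Set (EuclideanSpace ℝ (Fin d)))
        (wstar : EuclideanSpace ℝ (Fin d)) (n T : ℕ) (η : Fin T → ℝ) (γ : ℝ),
        (∀ w, Measurable (f w)) →
        (∀ z w, 0 ≤ f w z) →
        (∀ z, ConvexOn ℝ Set.univ (fun w => f w z)) →
        (∀ z, ProjSGD.LSmooth L (fun w => f w z)) →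
        IsClosed Ω → Convex ℝ Ω →
        wstar ∈ Ω → Integrable (f wstar) ρ → IsMinOn (ProjSGD.risk ρ f) Ω wstar → ‖wstar‖ ≤ B →
        0 < n → 0 < T →
        (∀ t, 0 < η t) → Antitone η → (∀ t, η t ≤ 1 / (2 * L)) →
        1 ≤ γ →
        Integrable (fun ω => ProjSGD.risk ρ f (ProjSGD.average f Ω η ω.1 ω.2))
            (ProjSGD.law ρ n T) ∧
          (∫ ω, ProjSGD.risk ρ f (ProjSGD.average f Ω η ω.1 ω.2) ∂(ProjSGD.law ρ n T))
              - ProjSGD.risk ρ f wstar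
            ≤ C * ((1 / γ + (∑ t, η t ^ 2) / (∑ t, η t)) * ProjSGD.risk ρ f wstar
                + 1 / (∑ t, η t)
                + γ * (1 + (T : ℝ) / n) / n
                    * (1 + (∑ t, η t ^ 2) * ProjSGD.risk ρ f wstar)) :=
  ⟨_, ProjSGD.excessRiskConst_pos hL B,
    fun _ _ _ _ _ _ _ _ _ _ _ _ hm h0 hcv hsm hc hconv hy hint _ =>
      mainTheorem3_general ⟨hL, h0, hsm⟩ hm hcv hc hconv hy hint⟩
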